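/- **Definitions.** Let $(P,\le)$ be a partially ordered set. A subset $R\subseteq P$ is *upwards-centered* if every finite subset of $R$ has an upper bound in $P$, and $P$ is *upwards-$\sigma$-centered* if it is the union of countably many upwards-centered subsets. The cardinal $\mathfrak p$ is the least cardinal $\mu$ for which there are a non-empty upwards-$\sigma$-centered partially ordered set $P$ and a family $(D_\alpha)_{\alpha<\mu}$ of cofinal subsets of $P$ such that no upwards-directed subset of $P$ meets every $D_\alpha$. A subset $C$ of a topological space is *irreducible* if it is closed, non-empty, and any two non-empty relatively open subsets of $C$ intersect. A space is *sober* if it is $T_0$ and every irreducible subset is the closure of a point. It is *locally compact* if every open set contains a compact neighborhood of each of its points. For sets $U,V$ write $U\ll V$ if every open cover of $V$ has a finite subcollection covering $U$; a space is *core compact* if every open set $O$ is a union of open sets $O'$ with $O'\ll O$. A space is *$\sigma$-centered* if its non-empty open sets, ordered by reverse inclusion, form an upwards-$\sigma$-centered partially ordered set. In a partially ordered set, $x$ is *way below* $y$ if for every non-empty directed set $D$ that has a supremum with $y\le\sup D$ there is $d\in D$ with $x\le d$; the partially ordered set is *upwards-continuous* if for every $y$ the set of elements way below $y$ is non-empty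 and directed, with supremum $y$. In a complete lattice $\mathcal L$ with least element $0$, an element $x$ is a *non-zero divisor* if $x\wedge y\ne 0$ for all $y\neq 0$, and it is *irreducible* if $x=a\wedge b$ implies $x=a$ or $x=b$. The complete lattice $\mathcal L$ is *distributive* if its binary meet and join distribute over each other, and *downwards-$\sigma$-centered* if $\mathcal L\setminus\{0\}$ with the order reversed is upwards-$\sigma$-centered. **Proposition.** Let $\kappa$ be a cardinal. The following are equivalent. 1. $\kappa<\mathfrak p$. 2. In every non-empty separable locally compact sober space the intersection of $\kappa$ or fewer open dense sets is non-empty. 3. In every non-empty separable core compact space, if $\mathcal D$ is a collection of $\kappa$ or fewer open dense sets, then there is an irreducible set meeting every member of $\mathcal D$. 4. In every non-empty $\sigma$-centered locally compact sober space the intersection of $\kappa$ or fewer open dense sets is non-empty. 5. In every non-empty $\sigma$-centered core compact space, if $\mathcal D$ is a collection of $\kappa$ or fewer open dense sets, then there is an irreducible set meeting every member of $\mathcal D$. 6. If $\mathcal L$ is a downwards-$\sigma$-centered upwards-continuous distributive complete lattice with at least two elements and $D$ is a set of $\kappa$ or fewer non-zero divisors of $\mathcal L$, then there is an irreducible $p\in\mathcal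 L$ such that no element of $D$ is below $p$ (that is, $d\not\le p$ for all $d\in D$). -/

import Mathlib

universe u

/-- A subset `R` of a partially ordered set `P` is upwards-centered if every finite subset of `R`
has an upper bound in `P`. -/
def UpwardsCentered {P : Type u} [PartialOrder P] (R : Set P) : Prop :=
  ∀ F : Set P, F ⊆ R → F.Finite → BddAbove F

/-- A partially ordered set is upwards-σ-centered if it is the union of countably many
upwards-centered subsets. -/
def UpwardsSigmaCentered (P : Type u) [PartialOrder P] : Prop :=
  ∃ 𝒞 : Set (Set P), 𝒞.Countable ∧ (∀ R ∈ 𝒞, UpwardsCentered R) ∧ ⋃₀ 𝒞 = Set.univ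

/-- The cardinal `𝔭`: the least cardinal `μ` such that there are a non-empty upwards-σ-centered
partially ordered set `P` and a family of `μ` cofinal subsets of `P` such that no upwards-directed
subset of `P` meets every member of the family. -/
noncomputable def cardinalP : Cardinal.{u} :=
  sInf {μ : Cardinal.{u} |
    ∃ (P : Type u) (_ : PartialOrder P), Nonempty P ∧ UpwardsSigmaCentered P ∧
      ∃ (ι : Type u) (D : ι → Set P), Cardinal.mk ι = μ ∧ (∀ i, IsCofinal (D i)) ∧
        ¬ ∃ S : Set P, DirectedOn (· ≤ ·) S ∧ ∀ i, (S ∩ D i).Nonempty}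

/-- A topological space is sober if it is `T₀` and every irreducible closed subset is the closure
of a point. -/
def SoberSpace (X : Type u) [TopologicalSpace X] : Prop :=
  T0Space X ∧ QuasiSober X

/-- `U` is compact in `V` (written `U ≪ V`): every open cover of `V` has a finite subcollection
which covers `U`. -/
def CompactIn {X : Type u} [TopologicalSpace X] (U V : Set X) : Prop :=
  ∀ 𝒰 : Set (Set X), (∀ W ∈ 𝒰, IsOpen W) → V ⊆ ⋃₀ 𝒰 →
    ∃ ℱ : Set (Set X), ℱ ⊆ 𝒰 ∧ ℱ.Finite ∧ U ⊆ ⋃₀ ℱ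

/-- A space is core compact if every open set `O` is the union of open sets `O'` with
`O' ≪ O`. -/
def CoreCompact (X : Type u) [TopologicalSpace X] : Prop :=
  ∀ O : Set X, IsOpen O →
    ∃ 𝒮 : Set (Set X), (∀ O' ∈ 𝒮, IsOpen O' ∧ CompactIn O' O) ∧ ⋃₀ 𝒮 = O

/-- A space is σ-centered if its non-empty open sets, ordered by reverse inclusion, form an
upwards-σ-centered partially ordered set. -/
def SigmaCenteredSpace (X : Type u) [TopologicalSpace X] : Prop :=
  UpwardsSigmaCentered {O : TopologicalSpace.Opens X // O ≠ ⊥}ᵒᵈ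

/-- `x` is way below `y`: for every (non-empty) directed set `D` with a supremum `s`, if `y ≤ s`
then `x ≤ d` for some `d ∈ D`. -/
def WayBelow {P : Type u} [PartialOrder P] (x y : P) : Prop :=
  ∀ (D : Set P) (s : P), D.Nonempty → DirectedOn (· ≤ ·) D → IsLUB D s → y ≤ s → ∃ d ∈ D, x ≤ d

/-- A partially ordered set is upwards-continuous if for every `y` the set of elements way below
`y` is directed (and non-empty) with supremum `y`. -/
def UpwardsContinuous (P : Type u) [PartialOrder P] : Prop :=
  ∀ y : P, {x : P | WayBelow x y}.Nonempty ∧ DirectedOn (· ≤ ·) {x : P | WayBelow x y} ∧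
    IsLUB {x : P | WayBelow x y} y

/-- The two distributive laws for the binary operations of a lattice. -/
def DistributiveLattice (L : Type u) [Lattice L] : Prop :=
  (∀ a b c : L, a ⊓ (b ⊔ c) = (a ⊓ b) ⊔ (a ⊓ c)) ∧
  (∀ a b c : L, a ⊔ (b ⊓ c) = (a ⊔ b) ⊓ (a ⊔ c))

/-- A complete lattice is downwards-σ-centered if its non-zero elements, with the order reversed,
form an upwards-σ-centered partially ordered set. -/
def DownwardsSigmaCentered (L : Type u) [CompleteLattice L] : Prop :=
  UpwardsSigmaCentered {x : L // x ≠ ⊥}ᵒᵈ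

/-- `x` is a non-zero divisor if `x ⊓ y ≠ 0` for every `y ≠ 0`. -/
def NonZeroDivisorElt {L : Type u} [CompleteLattice L] (x : L) : Prop :=
  ∀ y : L, y ≠ ⊥ → x ⊓ y ≠ ⊥

/-- `x` is irreducible if `x = a ⊓ b` implies `x = a` or `x = b`. -/
def IrreducibleElt {L : Type u} [CompleteLattice L] (x : L) : Prop :=
  ∀ a b : L, x = a ⊓ b → x = a ∨ x = b

/-- The intersection of `κ` or fewer open dense subsets of `X` is non-empty. -/
def OpenDenseInterNonempty (κ : Cardinal.{u}) (X : Type u) [TopologicalSpace X] : Prop :=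
  ∀ 𝒟 : Set (Set X), Cardinal.mk 𝒟 ≤ κ → (∀ O ∈ 𝒟, IsOpen O ∧ Dense O) → (⋂₀ 𝒟).Nonempty

/-- For every collection of `κ` or fewer open dense subsets of `X` there is an irreducible closed
set meeting each of them. -/
def OpenDenseMetByIrreducible (κ : Cardinal.{u}) (X : Type u) [TopologicalSpace X] : Prop :=
  ∀ 𝒟 : Set (Set X), Cardinal.mk 𝒟 ≤ κ → (∀ O ∈ 𝒟, IsOpen O ∧ Dense O) →
    ∃ C : Set X, IsClosed C ∧ IsIrreducible C ∧ ∀ O ∈ 𝒟, (C ∩ O).Nonempty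

/-! From `κ < 𝔭` to lattices: order the non-zero elements by "equal or way below".
Upwards-continuity keeps this order σ-centered and makes the elements below a non-zero divisor
cofinal, so some directed set meets all these cofinal sets. It yields a filter that omits `⊥`,
contains the given divisors and has, with each element, one way below it; an element maximal outside
such a filter is irreducible. Open-set lattices of core compact spaces are continuous, and
complements of proper irreducible opens are irreducible sets, which sobriety turns into points.

Conversely, if `𝔭 ≤ κ`, take a poset and a cofinal family witnessing `𝔭`, and shrink the poset to at
most `κ` elements. Its centered subsets form a separable locally compact sober space in which
meeting a cofinal set is an open dense condition. At most `κ` such conditions make a point meet the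
whole family and be directed, a contradiction. -/

section WayBelow

variable {P : Type u} [PartialOrder P] {x y z : P}

theorem WayBelow.le (h : WayBelow x y) : x ≤ y := by
  obtain ⟨d, hd, hxd⟩ := h {y} y (Set.singleton_nonempty y) (directedOn_singleton (a := y))
    isLUB_singleton le_rfl
  simp only [Set.mem_singleton_iff] at hd
  exact hd ▸ hxd

theorem WayBelow.mono_right (h : WayBelow x y) (hyz : y ≤ z) : WayBelow x z :=
  fun D s hne hD hs hz => h D s hne hD hs (hyz.trans hz)

end WayBelow

/-! ### Irreducible elements of continuous lattices -/

theorem UpwardsContinuous.exists_wayBelow_ne_bot {L : Type u} [CompleteLattice L]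
    (hL : UpwardsContinuous L) {y : L} (hy : y ≠ ⊥) : ∃ x, x ≠ ⊥ ∧ WayBelow x y := by
  by_contra! h
  refine hy (le_bot_iff.1 ((hL y).2.2.2 ?_))
  intro x hx
  by_contra hne
  exact h x (fun h0 => hne h0.le) hx

/-- A filter in which every element has an element of the filter way below it, and which omits `⊥`,
is avoided by an irreducible element, maximal in the complement of the filter. -/
theorem exists_irreducibleElt_of_open_filter {L : Type u} [CompleteLattice L] (F : Set L)
    (hup : ∀ x ∈ F, ∀ y, x ≤ y → y ∈ F) (hinf : ∀ x ∈ F, ∀ y ∈ F, x ⊓ y ∈ F)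
    (hopen : ∀ x ∈ F, ∃ y ∈ F, WayBelow y x) (hbot : ⊥ ∉ F) :
    ∃ p, IrreducibleElt p ∧ ∀ d ∈ F, ¬ d ≤ p := by
  -- Chains outside `F` have their supremum outside `F`: otherwise an element of `F` way below it
  -- would lie under a member of the chain.
  obtain ⟨p, -, hp⟩ := zorn_le_nonempty₀ {x | x ∉ F} (fun c hc hchain y hy => by
    refine ⟨sSup c, fun hmem => ?_, fun z hz => le_sSup hz⟩
    obtain ⟨u, hu, hwb⟩ := hopen _ hmem
    obtain ⟨d, hd, hud⟩ := hwb c (sSup c) ⟨y, hy⟩ hchain.directedOn (isLUB_sSup c) le_rfl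
    exact hc hd (hup u hu d hud)) ⊥ hbot
  have hmax : ∀ a, p ≤ a → p ≠ a → a ∈ F := fun a hpa hne => by
    by_contra ha
    exact hne (le_antisymm hpa (hp.2 ha hpa))
  refine ⟨p, fun a b hab => ?_, fun d hd hdp => hp.1 (hup d hd p hdp)⟩
  by_contra! h
  exact hp.1 (hab ▸ hinf a (hmax a (hab ▸ inf_le_left) h.1) b (hmax b (hab ▸ inf_le_right) h.2))

/-- The non-zero elements of a complete lattice, where `y` extends `x` if `y = x` or `y` is way
below `x`. -/
@[reducible]
def wayBelowOrder (L : Type u) [CompleteLattice L] : PartialOrder {x : L // x ≠ ⊥} where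
  le x y := y = x ∨ WayBelow (y : L) x
  lt x y := (y = x ∨ WayBelow (y : L) x) ∧ ¬ (x = y ∨ WayBelow (x : L) y)
  lt_iff_le_not_ge _ _ := Iff.rfl
  le_refl x := Or.inl rfl
  le_trans x y z := by
    rintro (rfl | hxy) (rfl | hyz)
    · exact Or.inl rfl
    · exact Or.inr hyz
    · exact Or.inr hxy
    · exact Or.inr (hyz.mono_right hxy.le)
  le_antisymm x y := by
    rintro (rfl | hxy) (h | hyx)
    · rfl
    · rfl
    · exact h
    · exact Subtype.ext (le_antisymm hyx.le hxy.le)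

theorem upwardsSigmaCentered_wayBelowOrder {L : Type u} [CompleteLattice L]
    (hσ : DownwardsSigmaCentered L) (hL : UpwardsContinuous L) :
    @UpwardsSigmaCentered {x : L // x ≠ ⊥} (wayBelowOrder L) := by
  obtain ⟨𝒞, hcount, hcent, hcov⟩ := hσ
  refine ⟨(fun R => OrderDual.toDual ⁻¹' R) '' 𝒞, hcount.image _, ?_, ?_⟩
  · rintro _ ⟨R, hR, rfl⟩ F hF hfin
    obtain ⟨w, hw⟩ := hcent R hR (OrderDual.toDual '' F) (by
      rintro _ ⟨x, hx, rfl⟩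
      exact hF hx) (hfin.image _)
    obtain ⟨z, hz, hzw⟩ := hL.exists_wayBelow_ne_bot (OrderDual.ofDual w).2
    refine ⟨⟨z, hz⟩, fun x hx => Or.inr ?_⟩
    exact hzw.mono_right (show OrderDual.ofDual w ≤ x from hw ⟨x, hx, rfl⟩)
  · ext x
    simp only [Set.sUnion_image, Set.mem_iUnion, Set.mem_preimage, Set.mem_univ, iff_true]
    have : OrderDual.toDual x ∈ ⋃₀ 𝒞 := hcov ▸ Set.mem_univ _
    obtain ⟨R, hR, hx⟩ := this
    exact ⟨R, hR, hx⟩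

theorem exists_directedOn_of_lt_cardinalP {P : Type u} [PartialOrder P] [Nonempty P]
    (hP : UpwardsSigmaCentered P) {ι : Type u} (D : ι → Set P) (hD : ∀ i, IsCofinal (D i))
    (hι : Cardinal.mk ι < cardinalP.{u}) :
    ∃ S : Set P, DirectedOn (· ≤ ·) S ∧ ∀ i, (S ∩ D i).Nonempty := by
  by_contra h
  exact notMem_of_lt_csInf' hι ⟨P, _, inferInstance, hP, ι, D, rfl, hD, h⟩

theorem exists_irreducibleElt_of_lt_cardinalP {κ : Cardinal.{u}} (hκ : κ < cardinalP.{u})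
    (L : Type u) [CompleteLattice L] [Nontrivial L] (hσ : DownwardsSigmaCentered L)
    (hL : UpwardsContinuous L) (D : Set L) (hDκ : Cardinal.mk D ≤ κ)
    (hD : ∀ d ∈ D, NonZeroDivisorElt d) : ∃ p : L, IrreducibleElt p ∧ ∀ d ∈ D, ¬ d ≤ p := by
  have hne : Nonempty {x : L // x ≠ ⊥} := ⟨⟨⊤, top_ne_bot⟩⟩
  obtain ⟨S, hS, hSD⟩ := @exists_directedOn_of_lt_cardinalP _ (wayBelowOrder L) hne
    (upwardsSigmaCentered_wayBelowOrder hσ hL) D (fun d => {x | (x : L) ≤ d}) (by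
      rintro ⟨d, hd⟩ ⟨x, hx⟩
      obtain ⟨z, hz, hzd⟩ := hL.exists_wayBelow_ne_bot (hD d hd x hx)
      exact ⟨⟨z, hz⟩, hzd.le.trans inf_le_left, Or.inr (hzd.mono_right inf_le_right)⟩)
    (hDκ.trans_lt hκ)
  by_cases hmax : ∀ s ∈ S, ∃ t ∈ S, WayBelow (t : L) s
  · obtain ⟨p, hp, hpF⟩ := exists_irreducibleElt_of_open_filter {y : L | ∃ s ∈ S, (s : L) ≤ y}
      (fun x ⟨s, hs, hsx⟩ y hxy => ⟨s, hs, hsx.trans hxy⟩)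
      (fun x ⟨s, hs, hsx⟩ y ⟨t, ht, hty⟩ => by
        obtain ⟨u, hu, hsu, htu⟩ := hS s hs t ht
        have key : ∀ v w : {x : L // x ≠ ⊥}, (v = w ∨ WayBelow (v : L) w) → (v : L) ≤ w := by
          rintro v w (rfl | h)
          · exact le_rfl
          · exact h.le
        exact ⟨u, hu, le_inf ((key u s hsu).trans hsx) ((key u t htu).trans hty)⟩)
      (fun x ⟨s, hs, hsx⟩ => by
        obtain ⟨t, ht, hts⟩ := hmax s hs
        exact ⟨t, ⟨t, ht, le_rfl⟩, hts.mono_right hsx⟩)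
      (fun ⟨s, hs, h⟩ => s.2 (le_bot_iff.1 h))
    exact ⟨p, hp, fun d hd => hpF d (by
      obtain ⟨s, hs, hsd⟩ := hSD ⟨d, hd⟩
      exact ⟨s, hs, hsd⟩)⟩
  -- Nothing in `S` is way below `s`, so by directedness `s` is least in `S` for the lattice order.
  -- Iterated way-below steps from `s` then generate the filter instead of `S`.
  · push Not at hmax
    obtain ⟨s, hs, hsmax⟩ := hmax
    have hmin : ∀ t ∈ S, (s : L) ≤ t := fun t ht => by
      obtain ⟨u, hu, hsu, htu⟩ := hS s hs t ht
      rcases hsu with rfl | hsu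
      · rcases htu with rfl | htu
        · exact le_rfl
        · exact htu.le
      · exact absurd hsu (hsmax u hu)
    choose f hf0 hf using fun x : {x : L // x ≠ ⊥} => hL.exists_wayBelow_ne_bot x.2
    let g : ℕ → {x : L // x ≠ ⊥} := fun n => (fun x => ⟨f x, hf0 x⟩)^[n] s
    have hg : ∀ n, WayBelow (g (n + 1) : L) (g n) := fun n => by
      simp only [g, Function.iterate_succ_apply']
      exact hf _
    have hanti : Antitone fun n => (g n : L) := antitone_nat_of_succ_le fun n => (hg n).le
    obtain ⟨p, hp, hpF⟩ := exists_irreducibleElt_of_open_filter {y : L | ∃ n, (g n : L) ≤ y}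
      (fun x ⟨n, hn⟩ y hxy => ⟨n, hn.trans hxy⟩)
      (fun x ⟨m, hm⟩ y ⟨n, hn⟩ => ⟨max m n, le_inf ((hanti (le_max_left m n)).trans hm)
        ((hanti (le_max_right m n)).trans hn)⟩)
      (fun x ⟨n, hn⟩ => ⟨g (n + 1), ⟨n + 1, le_rfl⟩, (hg n).mono_right hn⟩)
      (fun ⟨n, hn⟩ => (g n).2 (le_bot_iff.1 hn))
    exact ⟨p, hp, fun d hd => hpF d (by
      obtain ⟨t, ht, htd⟩ := hSD ⟨d, hd⟩
      exact ⟨0, (hmin t ht).trans htd⟩)⟩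

/-! ### Transfer between spaces and their lattices of open sets -/

section Topology

open TopologicalSpace

variable {X : Type u} [TopologicalSpace X]

theorem CompactIn.wayBelow {U V : Opens X} (h : CompactIn (U : Set X) V) : WayBelow U V := by
  intro D s hne hD hs hVs
  have hs' : s = sSup D := hs.unique (isLUB_sSup D)
  obtain ⟨T, hTD, hfin, hU⟩ := Set.exists_subset_image_finite_and.1
    (h ((fun W : Opens X => (W : Set X)) '' D) (by rintro _ ⟨W, -, rfl⟩; exact W.2) (by
      intro x hx
      have hx' : x ∈ sSup D := hs' ▸ hVs hx
      obtain ⟨W, hW, hxW⟩ := Opens.mem_sSup.1 hx'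
      exact ⟨W, ⟨W, hW, rfl⟩, hxW⟩))
  have : Nonempty D := hne.to_subtype
  have : Finite T := hfin
  obtain ⟨W, hW⟩ := hD.directed_val.finite_le (fun t : T => (⟨t, hTD t.2⟩ : D))
  refine ⟨W, W.2, fun x hx => ?_⟩
  obtain ⟨_, ⟨V', hV', rfl⟩, hx'⟩ := hU hx
  exact hW ⟨V', hV'⟩ hx'

theorem CoreCompact.upwardsContinuous_opens (hX : CoreCompact X) :
    UpwardsContinuous (Opens X) := by
  intro V
  refine ⟨⟨⊥, fun D s ⟨d, hd⟩ _ _ _ => ⟨d, hd, bot_le⟩⟩, ?_, fun U hU => hU.le, ?_⟩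
  · intro U₁ h₁ U₂ h₂
    refine ⟨U₁ ⊔ U₂, fun D s hne hD hs hV => ?_, le_sup_left, le_sup_right⟩
    obtain ⟨d₁, hd₁, hU₁⟩ := h₁ D s hne hD hs hV
    obtain ⟨d₂, hd₂, hU₂⟩ := h₂ D s hne hD hs hV
    obtain ⟨d, hd, h₁d, h₂d⟩ := hD d₁ hd₁ d₂ hd₂
    exact ⟨d, hd, sup_le (hU₁.trans h₁d) (hU₂.trans h₂d)⟩
  · intro W hW x hx
    obtain ⟨𝒮, h𝒮, hcov⟩ := hX V V.2
    have hx' : x ∈ ⋃₀ 𝒮 := hcov ▸ hx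
    obtain ⟨U, hU, hxU⟩ := hx'
    have hle : (⟨U, (h𝒮 U hU).1⟩ : Opens X) ≤ W :=
      hW (CompactIn.wayBelow (U := ⟨U, (h𝒮 U hU).1⟩) (h𝒮 U hU).2)
    exact hle hxU

theorem IrreducibleElt.isIrreducible_compl {p : Opens X} (hp : IrreducibleElt p) (htop : p ≠ ⊤) :
    IsIrreducible (p : Set X)ᶜ := by
  refine ⟨Set.nonempty_compl.2 fun h => htop (Opens.ext h), ?_⟩
  rintro U V hU hV ⟨x, hxp, hxU⟩ ⟨y, hyp, hyV⟩
  by_contra hempty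
  have hUV : (⟨U, hU⟩ : Opens X) ⊓ ⟨V, hV⟩ ≤ p := fun z hz => by
    by_contra hzp
    exact hempty ⟨z, hzp, hz⟩
  -- Distributivity gives `p = (p ⊔ U) ⊓ (p ⊔ V)`, since `U ⊓ V ≤ p`.
  rcases hp (p ⊔ ⟨U, hU⟩) (p ⊔ ⟨V, hV⟩) (by rw [← sup_inf_left, sup_eq_left.2 hUV]) with h | h
  · exact hxp ((sup_eq_left.1 h.symm) hxU)
  · exact hyp ((sup_eq_left.1 h.symm) hyV)

theorem Dense.nonZeroDivisorElt {U : Opens X} (hU : Dense (U : Set X)) : NonZeroDivisorElt U := by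
  intro V hV h
  obtain ⟨x, hxV, hxU⟩ := hU.inter_open_nonempty V V.2 ((Opens.ne_bot_iff_nonempty _).1 hV)
  have : x ∈ U ⊓ V := ⟨hxU, hxV⟩
  rw [h] at this
  exact this

theorem openDenseMetByIrreducible_of_opens [Nonempty X] {κ : Cardinal.{u}}
    (h : ∀ D : Set (Opens X), Cardinal.mk D ≤ κ → (∀ d ∈ D, NonZeroDivisorElt d) →
      ∃ p : Opens X, IrreducibleElt p ∧ ∀ d ∈ D, ¬ d ≤ p) :
    OpenDenseMetByIrreducible κ X := by
  intro 𝒟 hκ h𝒟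
  obtain ⟨p, hp, hpD⟩ := h {U | (U : Set X) ∈ 𝒟}
    ((Cardinal.mk_le_of_injective (f := fun U : {U : Opens X | (U : Set X) ∈ 𝒟} =>
      (⟨(U : Opens X), U.2⟩ : 𝒟)) fun U V hUV =>
        Subtype.ext (Opens.ext (congrArg Subtype.val hUV))).trans hκ)
    fun U hU => (h𝒟 _ hU).2.nonZeroDivisorElt
  -- `⊤` counts as irreducible, but it can occur here only if `𝒟` is empty; any point closure then
  -- works.
  by_cases htop : p = ⊤
  · obtain ⟨x⟩ := ‹Nonempty X›
    refine ⟨closure {x}, isClosed_closure, isIrreducible_singleton.closure, fun O hO => ?_⟩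
    exact absurd (htop ▸ le_top) (hpD ⟨O, (h𝒟 O hO).1⟩ hO)
  · refine ⟨(p : Set X)ᶜ, p.2.isClosed_compl, hp.isIrreducible_compl htop, fun O hO => ?_⟩
    obtain ⟨x, hxO, hxp⟩ := Set.not_subset.1 (hpD ⟨O, (h𝒟 O hO).1⟩ hO)
    exact ⟨x, hxp, hxO⟩

theorem SigmaCenteredSpace.of_separableSpace (hX : SeparableSpace X) : SigmaCenteredSpace X := by
  obtain ⟨s, hs, hdense⟩ := exists_countable_dense X
  refine ⟨(fun x => {U | x ∈ (OrderDual.ofDual U).1}) '' s, hs.image _, ?_, ?_⟩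
  · rintro _ ⟨x, -, rfl⟩ F hF hfin
    have hopen : IsOpen (⋂ U ∈ F, ((OrderDual.ofDual U).1 : Set X)) :=
      hfin.isOpen_biInter fun U _ => (OrderDual.ofDual U).1.2
    have hx : x ∈ ⋂ U ∈ F, ((OrderDual.ofDual U).1 : Set X) := Set.mem_iInter₂.2 fun U hU => hF hU
    refine ⟨OrderDual.toDual ⟨⟨_, hopen⟩, fun h => ?_⟩, fun U hU => ?_⟩
    · have hx' : x ∈ (⊥ : Opens X) := h ▸ hx
      exact hx'
    · exact fun y hy => Set.mem_iInter₂.1 hy U hU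
  · ext U
    simp only [Set.sUnion_image, Set.mem_iUnion, Set.mem_univ, iff_true]
    obtain ⟨x, hxU, hx⟩ := hdense.inter_open_nonempty (OrderDual.ofDual U).1
      (OrderDual.ofDual U).1.2 ((Opens.ne_bot_iff_nonempty _).1 (OrderDual.ofDual U).2)
    exact ⟨x, hx, hxU⟩

theorem CoreCompact.of_locallyCompactSpace (hX : LocallyCompactSpace X) : CoreCompact X := by
  intro O hO
  refine ⟨{U | IsOpen U ∧ U ⊆ O ∧ CompactIn U O}, fun U hU => ⟨hU.1, hU.2.2⟩,
    Set.Subset.antisymm (Set.sUnion_subset fun U hU => hU.2.1) fun x hx => ?_⟩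
  obtain ⟨K, hK, hKO, hKc⟩ := local_compact_nhds (hO.mem_nhds hx)
  refine ⟨interior K, ⟨isOpen_interior, interior_subset.trans hKO, fun 𝒰 h𝒰 hcov => ?_⟩,
    mem_interior_iff_mem_nhds.2 hK⟩
  obtain ⟨ℱ, hℱ, hfin, hKℱ⟩ := hKc.elim_finite_subcover_image (c := id) h𝒰
    (by simpa only [Set.sUnion_eq_biUnion, id] using hKO.trans hcov)
  refine ⟨ℱ, hℱ, hfin, interior_subset.trans ?_⟩
  simpa only [Set.sUnion_eq_biUnion, id] using hKℱ

theorem OpenDenseMetByIrreducible.openDenseInterNonempty {κ : Cardinal.{u}}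
    (h : OpenDenseMetByIrreducible κ X) (hX : SoberSpace X) : OpenDenseInterNonempty κ X := by
  intro 𝒟 hκ h𝒟
  obtain ⟨C, hC, hirr, hmeet⟩ := h 𝒟 hκ h𝒟
  obtain ⟨x, hx⟩ := hX.2.sober hirr hC
  refine ⟨x, fun O hO => ?_⟩
  obtain ⟨y, hyC, hyO⟩ := hmeet O hO
  exact (hx.mem_open_set_iff (h𝒟 O hO).1).2 ⟨y, hyC, hyO⟩

end Topology

/-! ### Attainment of `𝔭` and reduction to small posets -/

open Cardinal

theorem UpwardsSigmaCentered.of_countable {P : Type u} [PartialOrder P] [Countable P] :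
    UpwardsSigmaCentered P := by
  refine ⟨Set.range fun p : P => {p}, Set.countable_range _, ?_, ?_⟩
  · rintro _ ⟨p, rfl⟩ F hF -
    exact ⟨p, fun q hq => (hF hq).le⟩
  · exact Set.eq_univ_of_forall fun p => ⟨{p}, ⟨p, rfl⟩, rfl⟩

/-- The complete binary tree of finite sequences, ordered by end-extension. -/
def BoolSeqTree : Type u := ULift.{u} (List Bool)

namespace BoolSeqTree

instance : Countable BoolSeqTree.{u} := inferInstanceAs (Countable (ULift (List Bool)))

instance : Nonempty BoolSeqTree.{u} := ⟨ULift.up []⟩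

instance : PartialOrder BoolSeqTree.{u} where
  le a b := a.down <+: b.down
  le_refl a := List.prefix_refl a.down
  le_trans _ _ _ h₁ h₂ := h₁.trans h₂
  le_antisymm a b h₁ h₂ := ULift.ext _ _ (h₁.eq_of_length (le_antisymm h₁.length_le h₂.length_le))

/-- If both one-step extensions of `p` lay in `S`, a common bound would have two distinct prefixes
of equal length. -/
theorem isCofinal_compl {S : Set BoolSeqTree.{u}} (hS : DirectedOn (· ≤ ·) S) : IsCofinal Sᶜ := by
  intro p
  by_contra! h
  have hmem : ∀ b : Bool, (ULift.up (p.down ++ [b]) : BoolSeqTree.{u}) ∈ S := fun b => by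
    by_contra hb
    exact h _ hb (List.prefix_append _ _)
  obtain ⟨r, -, h₀, h₁⟩ := hS _ (hmem false) _ (hmem true)
  have := (List.prefix_of_prefix_length_le h₀ h₁ (by simp)).eq_of_length (by simp)
  simp at this

end BoolSeqTree

/-- The infimum is attained because the set is non-empty: no directed `S` in the binary tree meets
every cofinal set, as it misses its own complement. -/
theorem cardinalP_mem : ∃ (P : Type u) (_ : PartialOrder P), Nonempty P ∧ UpwardsSigmaCentered P ∧
      ∃ (ι : Type u) (D : ι → Set P), #ι = cardinalP.{u} ∧ (∀ i, IsCofinal (D i)) ∧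
        ¬ ∃ S : Set P, DirectedOn (· ≤ ·) S ∧ ∀ i, (S ∩ D i).Nonempty := by
  refine csInf_mem (s := {μ : Cardinal.{u} |
    ∃ (P : Type u) (_ : PartialOrder P), Nonempty P ∧ UpwardsSigmaCentered P ∧
      ∃ (ι : Type u) (D : ι → Set P), #ι = μ ∧ (∀ i, IsCofinal (D i)) ∧
        ¬ ∃ S : Set P, DirectedOn (· ≤ ·) S ∧ ∀ i, (S ∩ D i).Nonempty})
    ⟨_, BoolSeqTree, inferInstance, inferInstance, .of_countable,
      {D : Set BoolSeqTree // IsCofinal D}, Subtype.val, rfl, Subtype.property, ?_⟩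
  rintro ⟨S, hS, hmeet⟩
  obtain ⟨p, hp, hp'⟩ := hmeet ⟨Sᶜ, BoolSeqTree.isCofinal_compl hS⟩
  exact hp' hp

/-- The Rasiowa–Sikorski argument; it makes a family witnessing `𝔭` uncountable. -/
theorem exists_directedOn_of_countable {P : Type u} [PartialOrder P] [Nonempty P] {ι : Type u}
    [Countable ι] (D : ι → Set P) (hD : ∀ i, IsCofinal (D i)) :
    ∃ S : Set P, DirectedOn (· ≤ ·) S ∧ ∀ i, (S ∩ D i).Nonempty := by
  have := Encodable.ofCountable ι
  let I := Order.idealOfCofinals (Classical.arbitrary P) fun i => ⟨D i, hD i⟩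
  refine ⟨I, I.directed, fun i => ?_⟩
  obtain ⟨x, hxD, hxI⟩ := Order.cofinal_meets_idealOfCofinals (Classical.arbitrary P)
    (fun i => (⟨D i, hD i⟩ : Order.Cofinal P)) i
  exact ⟨x, hxI, hxD⟩

/-- The language with one function symbol of each arity for each element of `ι`. -/
@[reducible]
def boundLanguage (ι : Type u) : FirstOrder.Language.{u, 0} where
  Functions _ := ι
  Relations _ := Empty

/-- A Löwenheim–Skolem closure: `f i F` picks a bound of `F` in `D i`, and `Q` is generated from `∅`
by these operations. Centeredness and cofinality then pass to `Q`. -/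
theorem exists_small_subset {P : Type u} [PartialOrder P] [Nonempty P] {ι : Type u} [Infinite ι]
    (D : ι → Set P) (hD : ∀ i, IsCofinal (D i)) :
    ∃ Q : Set P, #Q ≤ #ι ∧ ∀ F : Set P, F ⊆ Q → F.Finite → BddAbove F → ∀ i,
      ∃ q ∈ Q, q ∈ D i ∧ q ∈ upperBounds F := by
  have hf : ∀ (i : ι) (F : Set P), ∃ q, BddAbove F → q ∈ D i ∧ q ∈ upperBounds F := by
    intro i F
    by_cases hF : BddAbove F
    · obtain ⟨p, hp⟩ := hF
      obtain ⟨q, hq, hpq⟩ := hD i p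
      exact ⟨q, fun _ => ⟨hq, fun x hx => (hp hx).trans hpq⟩⟩
    · exact ⟨Classical.arbitrary P, fun h => absurd h hF⟩
  choose f hf using hf
  let _ : (boundLanguage ι).Structure P :=
    { funMap := fun {n} (i : ι) x => f i (Set.range x), RelMap := fun {n} r => nomatch r }
  let Q := FirstOrder.Language.Substructure.closure (boundLanguage ι) (∅ : Set P)
  refine ⟨Q, ?_, fun F hF hfin hbdd i => ?_⟩
  · have h := FirstOrder.Language.Substructure.lift_card_closure_le (L := boundLanguage ι)
      (s := (∅ : Set P))
    have hcard : #(Σ n : ℕ, (boundLanguage ι).Functions n) = #ι := by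
      simp [Cardinal.mk_sigma]
    rw [lift_id, lift_id, lift_id, hcard, mk_eq_zero (∅ : Set P), zero_add,
      max_eq_right (aleph0_le_mk ι)] at h
    exact h
  · have : Finite F := hfin
    obtain ⟨n, ⟨e⟩⟩ := Finite.exists_equiv_fin F
    have hrange : Set.range (fun k => (e.symm k : P)) = F := by
      rw [← Function.comp_def, e.symm.surjective.range_comp, Subtype.range_coe]
    refine ⟨f i F, ?_, hf i F hbdd⟩
    have := Q.fun_mem (n := n) (show (boundLanguage ι).Functions n from i)
      (fun k => (e.symm k : P)) fun k => hF (e.symm k).2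
    have h2 : f i (Set.range (fun k => (e.symm k : P))) ∈ Q := this
    rwa [hrange] at h2

/-! ### The space of centered subsets -/

/-- The centered subsets of a partially ordered set. -/
def CenteredSet (P : Type u) [PartialOrder P] : Type u := {A : Set P // UpwardsCentered A}

namespace CenteredSet

variable {P : Type u} [PartialOrder P]

/-- The centered sets containing `F`. -/
def basicOpen (F : Set P) : Set (CenteredSet P) := {A | F ⊆ A.1}

/-- The topology generated by the sets `basicOpen F`, where `F` is finite. -/
instance : TopologicalSpace (CenteredSet P) :=
  TopologicalSpace.generateFrom (basicOpen '' {F : Set P | F.Finite})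

theorem isTopologicalBasis :
    TopologicalSpace.IsTopologicalBasis (basicOpen '' {F : Set P | F.Finite}) where
  exists_subset_inter := by
    rintro _ ⟨F, hF, rfl⟩ _ ⟨G, hG, rfl⟩ A ⟨hFA, hGA⟩
    exact ⟨_, ⟨F ∪ G, hF.union hG, rfl⟩, Set.union_subset hFA hGA,
      fun B hB => ⟨Set.subset_union_left.trans hB, Set.subset_union_right.trans hB⟩⟩
  sUnion_eq := Set.eq_univ_of_forall fun A =>
    ⟨_, ⟨∅, Set.finite_empty, rfl⟩, Set.empty_subset A.1⟩
  eq_generateFrom := rfl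

theorem isOpen_basicOpen {F : Set P} (hF : F.Finite) : IsOpen (basicOpen F) :=
  isTopologicalBasis.isOpen ⟨F, hF, rfl⟩

theorem mem_of_subset {O : Set (CenteredSet P)} (hO : IsOpen O) {A B : CenteredSet P}
    (hA : A ∈ O) (hAB : A.1 ⊆ B.1) : B ∈ O := by
  obtain ⟨_, ⟨F, -, rfl⟩, hFA, hFO⟩ := isTopologicalBasis.exists_subset_of_mem_open hA hO
  exact hFO (hFA.trans hAB)

theorem nonempty_basicOpen {F : Set P} (hF : BddAbove F) : (basicOpen F).Nonempty := by
  obtain ⟨p, hp⟩ := hF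
  exact ⟨⟨F, fun G hG _ => ⟨p, fun x hx => hp (hG hx)⟩⟩, Set.Subset.refl F⟩

theorem bddAbove_of_nonempty {F : Set P} (hfin : F.Finite) (hF : (basicOpen F).Nonempty) :
    BddAbove F := by
  obtain ⟨A, hA⟩ := hF
  exact A.2 F hA hfin

/-- If the set is non-empty, `F` is itself its least point; open sets are closed under supersets, so
one member of a cover suffices. -/
theorem isCompact_basicOpen (F : Set P) : IsCompact (basicOpen F) := by
  rcases (basicOpen F).eq_empty_or_nonempty with h | ⟨A, hA⟩
  · exact h ▸ isCompact_empty
  · let B : CenteredSet P := ⟨F, fun G hG => A.2 G (hG.trans hA)⟩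
    refine isCompact_of_finite_subcover fun U hU hcov => ?_
    obtain ⟨i, hi⟩ := Set.mem_iUnion.1 (hcov (show B ∈ basicOpen F from Set.Subset.refl F))
    exact ⟨{i}, fun C hC => Set.mem_iUnion₂.2
      ⟨i, Finset.mem_singleton_self i, mem_of_subset (hU i) hi hC⟩⟩

instance : LocallyCompactSpace (CenteredSet P) where
  local_compact_nhds A n hn := by
    obtain ⟨_, ⟨F, hF, rfl⟩, hFA, hFn⟩ := isTopologicalBasis.mem_nhds_iff.1 hn
    exact ⟨basicOpen F, (isOpen_basicOpen hF).mem_nhds hFA, hFn, isCompact_basicOpen F⟩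

/-- The generic point of `C` is the union of its members: irreducibility puts each finite part of
the union inside a single member, so the union is centered. -/
theorem soberSpace : SoberSpace (CenteredSet P) := by
  refine ⟨⟨fun A B hAB => Subtype.ext (Set.ext fun p => ?_)⟩, ⟨fun {C} hC hclosed => ?_⟩⟩
  · have h := hAB.mem_open_iff (isOpen_basicOpen (Set.finite_singleton p))
    simpa [basicOpen] using h
  · have key : ∀ F : Set P, F.Finite → (∀ p ∈ F, ∃ B ∈ C, p ∈ B.1) →
        (C ∩ basicOpen F).Nonempty := by
      intro F hF
      induction F, hF using Set.Finite.induction_on with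
      | empty => exact fun _ => let ⟨B, hB⟩ := hC.1; ⟨B, hB, Set.empty_subset _⟩
      | @insert a s _ hs ih =>
        intro h
        obtain ⟨B, hB, haB⟩ := h a (Set.mem_insert _ _)
        obtain ⟨E, hE, hsE, haE⟩ := hC.2 _ _ (isOpen_basicOpen hs)
          (isOpen_basicOpen (Set.finite_singleton a))
          (ih fun p hp => h p (Set.mem_insert_of_mem _ hp))
          ⟨B, hB, Set.singleton_subset_iff.2 haB⟩
        exact ⟨E, hE, Set.insert_subset (Set.singleton_subset_iff.1 haE) hsE⟩
    let A : CenteredSet P := ⟨{p | ∃ B ∈ C, p ∈ B.1}, fun F hF hfin =>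
      bddAbove_of_nonempty hfin ((key F hfin hF).mono Set.inter_subset_right)⟩
    refine ⟨A, Set.Subset.antisymm (closure_minimal (Set.singleton_subset_iff.2 ?_) hclosed)
      fun B hB => isTopologicalBasis.mem_closure_iff.2 ?_⟩
    · rw [← hclosed.closure_eq]
      refine isTopologicalBasis.mem_closure_iff.2 ?_
      rintro _ ⟨F, hF, rfl⟩ hFA
      rw [Set.inter_comm]
      exact key F hF hFA
    · rintro _ ⟨F, hF, rfl⟩ hFB
      exact ⟨A, fun p hp => ⟨B, hB, hFB hp⟩, rfl⟩

/-- The downward closures of the countably many pieces are dense: a bound of `F` lies in some piece,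
whose downward closure contains `F`. -/
theorem separableSpace (hP : UpwardsSigmaCentered P) :
    TopologicalSpace.SeparableSpace (CenteredSet P) := by
  obtain ⟨𝒞, hcount, hcent, hcov⟩ := hP
  have hlower : ∀ R ∈ 𝒞, UpwardsCentered {p | ∃ r ∈ R, p ≤ r} := by
    intro R hR F hF hfin
    choose! g hg hgle using hF
    obtain ⟨b, hb⟩ := hcent R hR (g '' F) (Set.image_subset_iff.2 fun x hx => hg hx) (hfin.image g)
    exact ⟨b, fun x hx => (hgle hx).trans (hb ⟨x, hx, rfl⟩)⟩
  have : Countable 𝒞 := hcount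
  let e : 𝒞 → CenteredSet P := fun R => ⟨_, hlower R R.2⟩
  refine ⟨Set.range e, Set.countable_range e, isTopologicalBasis.dense_iff.2 ?_⟩
  rintro _ ⟨F, hF, rfl⟩ hne
  obtain ⟨p, hp⟩ := bddAbove_of_nonempty hF hne
  have hpc : p ∈ ⋃₀ 𝒞 := hcov ▸ Set.mem_univ p
  obtain ⟨R, hR, hpR⟩ := hpc
  exact ⟨e ⟨R, hR⟩, fun x hx => ⟨p, hpR, hp hx⟩, Set.mem_range_self _⟩

/-- The centered sets meeting `D`. -/
def meeting (D : Set P) : Set (CenteredSet P) := {A | (A.1 ∩ D).Nonempty}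

theorem isOpen_meeting (D : Set P) : IsOpen (meeting D) := by
  refine isTopologicalBasis.isOpen_iff.2 fun A ⟨p, hpA, hpD⟩ => ?_
  exact ⟨_, ⟨{p}, Set.finite_singleton p, rfl⟩, Set.singleton_subset_iff.2 hpA,
    fun B hB => ⟨p, hB rfl, hpD⟩⟩

theorem dense_meeting {D : Set P} (hD : IsCofinal D) : Dense (meeting D) := by
  refine isTopologicalBasis.dense_iff.2 ?_
  rintro _ ⟨F, hF, rfl⟩ hne
  obtain ⟨p, hp⟩ := bddAbove_of_nonempty hF hne
  obtain ⟨d, hd, hpd⟩ := hD p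
  obtain ⟨A, hA⟩ := nonempty_basicOpen (F := insert d F)
    ⟨d, Set.forall_mem_insert.2 ⟨le_rfl, fun x hx => (hp hx).trans hpd⟩⟩
  exact ⟨A, (Set.subset_insert d F).trans hA, d, hA (Set.mem_insert d F), hd⟩

end CenteredSet

/-! ### Directed sets from points of the space -/

/-- The elements bounding both `p` and `q`, or incompatible with one of them. -/
def decidingSet {P : Type u} [PartialOrder P] (p q : P) : Set P :=
  {r | (p ≤ r ∧ q ≤ r) ∨ (¬ ∃ t, r ≤ t ∧ p ≤ t) ∨ ¬ ∃ t, r ≤ t ∧ q ≤ t}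

theorem isCofinal_decidingSet {P : Type u} [PartialOrder P] (p q : P) :
    IsCofinal (decidingSet p q) := by
  intro s
  by_cases hp : ∃ t, s ≤ t ∧ p ≤ t
  · obtain ⟨t, hst, hpt⟩ := hp
    by_cases hq : ∃ u, t ≤ u ∧ q ≤ u
    · obtain ⟨v, htv, hqv⟩ := hq
      exact ⟨v, Or.inl ⟨hpt.trans htv, hqv⟩, hst.trans htv⟩
    · exact ⟨t, Or.inr (Or.inr hq), hst⟩
  · exact ⟨s, Or.inr (Or.inl hp), le_rfl⟩

/-- Members of a centered set are pairwise compatible, which rules out the incompatible alternatives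
of `decidingSet`. -/
theorem UpwardsCentered.directedOn {P : Type u} [PartialOrder P] {A : Set P}
    (hA : UpwardsCentered A) (h : ∀ p q, (A ∩ decidingSet p q).Nonempty) :
    DirectedOn (· ≤ ·) A := by
  intro p hp q hq
  obtain ⟨r, hrA, hr⟩ := h p q
  have hcompat : ∀ x ∈ A, ∃ t, r ≤ t ∧ x ≤ t := fun x hx => by
    obtain ⟨t, ht⟩ := hA {r, x} (Set.insert_subset hrA (Set.singleton_subset_iff.2 hx))
      (Set.toFinite _)
    exact ⟨t, ht (by simp), ht (by simp)⟩
  rcases hr with hr | hr | hr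
  · exact ⟨r, hrA, hr⟩
  · exact absurd (hcompat p hp) hr
  · exact absurd (hcompat q hq) hr

theorem exists_directedOn_of_openDenseInterNonempty {κ : Cardinal.{u}} (hκ : ℵ₀ ≤ κ)
    (h : ∀ (X : Type u) [TopologicalSpace X] [Nonempty X],
      TopologicalSpace.SeparableSpace X → LocallyCompactSpace X → SoberSpace X →
        OpenDenseInterNonempty κ X)
    {P : Type u} [PartialOrder P] [Nonempty P] (hP : UpwardsSigmaCentered P) (hPκ : #P ≤ κ)
    {ι : Type u} (hι : #ι ≤ κ) (D : ι → Set P) (hD : ∀ i, IsCofinal (D i)) :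
    ∃ S : Set P, DirectedOn (· ≤ ·) S ∧ ∀ i, (S ∩ D i).Nonempty := by
  let E : ι ⊕ P × P → Set P := Sum.elim D fun x => decidingSet x.1 x.2
  have hE : ∀ j, IsCofinal (E j) := by
    rintro (i | ⟨p, q⟩)
    · exact hD i
    · exact isCofinal_decidingSet p q
  have hcard : #(Set.range fun j => CenteredSet.meeting (E j)) ≤ κ := by
    refine mk_range_le.trans ?_
    rw [mk_sum, lift_id, lift_id, mk_prod, lift_id]
    exact add_le_of_le hκ hι (mul_le_of_le hκ hPκ hPκ)
  have : Nonempty (CenteredSet P) :=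
    (CenteredSet.nonempty_basicOpen (bddAbove_empty (α := P))).to_type
  obtain ⟨A, hA⟩ := h (CenteredSet P) (CenteredSet.separableSpace hP) inferInstance
    CenteredSet.soberSpace _ hcard (by
      rintro _ ⟨j, rfl⟩
      exact ⟨CenteredSet.isOpen_meeting _, CenteredSet.dense_meeting (hE j)⟩)
  have hmeet : ∀ j, (A.1 ∩ E j).Nonempty := fun j => hA _ ⟨j, rfl⟩
  exact ⟨A.1, A.2.directedOn fun p q => hmeet (Sum.inr (p, q)), fun i => hmeet (Sum.inl i)⟩

theorem lt_cardinalP_of_openDenseInterNonempty {κ : Cardinal.{u}}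
    (h : ∀ (X : Type u) [TopologicalSpace X] [Nonempty X],
      TopologicalSpace.SeparableSpace X → LocallyCompactSpace X → SoberSpace X →
        OpenDenseInterNonempty κ X) : κ < cardinalP.{u} := by
  by_contra! hκ
  obtain ⟨P, _, _, hP, ι, D, hι, hD, hno⟩ := cardinalP_mem.{u}
  rcases finite_or_infinite ι with hfin | hinf
  · exact hno (exists_directedOn_of_countable D hD)
  have hικ : #ι ≤ κ := hι.trans_le hκ
  obtain ⟨Q, hQ, hbound⟩ := exists_small_subset D hD
  obtain ⟨i₀⟩ : Nonempty ι := inferInstance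
  obtain ⟨q₀, hq₀, -⟩ := hbound ∅ (Set.empty_subset Q) Set.finite_empty bddAbove_empty i₀
  have : Nonempty Q := ⟨⟨q₀, hq₀⟩⟩
  have hQσ : UpwardsSigmaCentered Q := by
    obtain ⟨𝒞, hcount, hcent, hcov⟩ := hP
    refine ⟨(fun R => Subtype.val ⁻¹' R) '' 𝒞, hcount.image _, ?_, ?_⟩
    · rintro _ ⟨R, hR, rfl⟩ F hF hFfin
      have hsub : Subtype.val '' F ⊆ R := Set.image_subset_iff.2 hF
      -- The index `i₀` is arbitrary: only a bound inside `Q` is wanted.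
      obtain ⟨q, hq, -, hub⟩ := hbound (Subtype.val '' F) (by rintro _ ⟨x, -, rfl⟩; exact x.2)
        (hFfin.image _) (hcent R hR _ hsub (hFfin.image _)) i₀
      exact ⟨⟨q, hq⟩, fun x hx => hub ⟨x, hx, rfl⟩⟩
    · ext x
      have hx : (x : P) ∈ ⋃₀ 𝒞 := hcov ▸ Set.mem_univ _
      obtain ⟨R, hR, hxR⟩ := hx
      simp only [Set.sUnion_image, Set.mem_iUnion, Set.mem_preimage, Set.mem_univ, iff_true]
      exact ⟨R, hR, hxR⟩
  obtain ⟨S, hS, hmeet⟩ := exists_directedOn_of_openDenseInterNonempty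
    ((aleph0_le_mk ι).trans hικ) h hQσ (hQ.trans hικ) hικ (fun i => Subtype.val ⁻¹' D i) (by
      intro i q
      obtain ⟨r, hr, hrD, hub⟩ := hbound {(q : P)} (Set.singleton_subset_iff.2 q.2)
        (Set.finite_singleton _) bddAbove_singleton i
      exact ⟨⟨r, hr⟩, hrD, hub rfl⟩)
  refine hno ⟨Subtype.val '' S, ?_, fun i => ?_⟩
  · rintro _ ⟨x, hx, rfl⟩ _ ⟨y, hy, rfl⟩
    obtain ⟨z, hz, hxz, hyz⟩ := hS x hx y hy
    exact ⟨z, ⟨z, hz, rfl⟩, hxz, hyz⟩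
  · obtain ⟨x, hx, hxD⟩ := hmeet i
    exact ⟨x, ⟨x, hx, rfl⟩, hxD⟩

theorem proposition2 (κ : Cardinal.{u}) :
    [κ < cardinalP.{u},
      ∀ (X : Type u) [TopologicalSpace X] [Nonempty X],
        TopologicalSpace.SeparableSpace X → LocallyCompactSpace X → SoberSpace X →
          OpenDenseInterNonempty κ X,
      ∀ (X : Type u) [TopologicalSpace X] [Nonempty X],
        TopologicalSpace.SeparableSpace X → CoreCompact X →
          OpenDenseMetByIrreducible κ X,
      ∀ (X : Type u) [TopologicalSpace X] [Nonempty X],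
        SigmaCenteredSpace X → LocallyCompactSpace X → SoberSpace X →
          OpenDenseInterNonempty κ X,
      ∀ (X : Type u) [TopologicalSpace X] [Nonempty X],
        SigmaCenteredSpace X → CoreCompact X →
          OpenDenseMetByIrreducible κ X,
      ∀ (L : Type u) [CompleteLattice L] [Nontrivial L],
        DownwardsSigmaCentered L → UpwardsContinuous L → DistributiveLattice L →
          ∀ D : Set L, Cardinal.mk D ≤ κ → (∀ d ∈ D, NonZeroDivisorElt d) →
            ∃ p : L, IrreducibleElt p ∧ ∀ d ∈ D, ¬ d ≤ p].TFAE := by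
  tfae_have 1 → 6 := fun hκ L _ _ hσ hL _ D hDκ hD =>
    exists_irreducibleElt_of_lt_cardinalP hκ L hσ hL D hDκ hD
  tfae_have 6 → 5 := fun h X _ _ hσ hX => openDenseMetByIrreducible_of_opens
    (h (TopologicalSpace.Opens X) hσ hX.upwardsContinuous_opens ⟨inf_sup_left, sup_inf_left⟩)
  tfae_have 5 → 3 := fun h X _ _ hs hX => h X (.of_separableSpace hs) hX
  tfae_have 5 → 4 := fun h X _ _ hσ hX hsob =>
    (h X hσ (.of_locallyCompactSpace hX)).openDenseInterNonempty hsob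
  tfae_have 3 → 2 := fun h X _ _ hs hX hsob =>
    (h X hs (.of_locallyCompactSpace hX)).openDenseInterNonempty hsob
  tfae_have 4 → 2 := fun h X _ _ hs hX hsob => h X (.of_separableSpace hs) hX hsob
  tfae_have 2 → 1 := lt_cardinalP_of_openDenseInterNonempty
  tfae_finish
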